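/- Let $(N,g)$ be a smooth Riemannian manifold of dimension $n\ge 1$ (without boundary, not assumed complete or connected), let $f\in C^\infty(N)$, and consider the smooth metric measure space $(N,g,e^{-f}\,d\mathrm{vol})$. Denote by $\nabla$, $\nabla^2$, $\Delta$, $\mathrm{Ric}$ and $R$ the gradient, the Hessian, the Laplace-Beltrami operator ($\Delta=\operatorname{tr}_g\nabla^2$), the Ricci tensor and the scalar curvature of $g$. Let $\lambda,\rho\in\mathbb R$ and $0<m\le\infty$ be constants (with $\frac1m=0$ if $m=\infty$) such that, as quadratic forms on every tangent space, $$\mathrm{Ric}+\nabla^2 f-\frac1m\,df\otimes df\ \ge\ \lambda g+\rho R g .$$ Let $u$ be a positive smooth $f$-harmonic function on $N$, that is, $\Delta_f u:=\Delta u-\langle\nabla f,\nabla u\rangle=0$, and put $\omega=\log u$ and $F=|\nabla\omega|^2$. Then, at every point of $N$, $$\frac12\Delta F\ \ge\ (\lambda+\rho R)F+\frac1n F^2-\frac2n|\nabla f|F^{3/2}-|\nabla F|F^{1/2}+\frac1m\bigl(df(\nabla\omega)\bigr)^2+\frac12\langle\nabla f,\nabla F\rangle .$$ -/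

import Mathlib

open Bundle Manifold ContDiff
open scoped ENNReal

noncomputable section

namespace RiemGeom

variable {n : ℕ} {N : Type*} [TopologicalSpace N] [ChartedSpace (EuclideanSpace ℝ (Fin n)) N]

/-- The `i`-th partial derivative of a real function on `ℝⁿ`. -/
def pd (i : Fin n) (h : EuclideanSpace ℝ (Fin n) → ℝ) (y : EuclideanSpace ℝ (Fin n)) : ℝ :=
  fderiv ℝ h y (EuclideanSpace.single i 1)

/-- The `i`-th coordinate vector field `∂ᵢ` of the chart at `p`, at the point with coordinates
`y`. -/
def coordVec (p : N) (i : Fin n) (y : EuclideanSpace ℝ (Fin n)) :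
    TangentSpace (𝓡 n) ((extChartAt (𝓡 n) p).symm y) :=
  mfderiv 𝓘(ℝ, EuclideanSpace ℝ (Fin n)) (𝓡 n) (extChartAt (𝓡 n) p).symm y
    (EuclideanSpace.single i (1 : ℝ) : EuclideanSpace ℝ (Fin n))

/-- The component `dxⁱ(v)` of a tangent vector `v` at `p` in the chart at `p`. -/
def tangentCoord (p : N) (v : TangentSpace (𝓡 n) p) (i : Fin n) : ℝ :=
  mvfderiv (𝓡 n) (extChartAt (𝓡 n) p) p v i

/-- The differential `dh(p)` of a real function, as a linear form on the tangent space. -/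
def differential (h : N → ℝ) (p : N) : TangentSpace (𝓡 n) p →L[ℝ] ℝ :=
  mvfderiv (𝓡 n) h p

/-- The second partial derivative `∂ᵢ∂ⱼh` of a function read in the chart at `p`. -/
def pd₂ (h : N → ℝ) (p : N) (i j : Fin n) (y : EuclideanSpace ℝ (Fin n)) : ℝ :=
  pd i (pd j (h ∘ (extChartAt (𝓡 n) p).symm)) y

/-- Tangent spaces are finite-dimensional. -/
theorem finiteDimensional_tangentSpace (p : N) : FiniteDimensional ℝ (TangentSpace (𝓡 n) p) :=
  inferInstanceAs (FiniteDimensional ℝ (EuclideanSpace ℝ (Fin n)))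

variable [RiemannianBundle (fun x : N ↦ TangentSpace (𝓡 n) x)]

/-- The gradient `∇h(p)`: the Riesz representative of `dh(p)` with respect to the metric, i.e.
`⟨∇h(p), v⟩ = dh(p)(v)` for all tangent vectors `v`. -/
def grad (h : N → ℝ) (p : N) : TangentSpace (𝓡 n) p :=
  haveI := finiteDimensional_tangentSpace (n := n) p
  haveI : CompleteSpace (TangentSpace (𝓡 n) p) := FiniteDimensional.complete ℝ _
  (InnerProductSpace.toDual ℝ (TangentSpace (𝓡 n) p)).symm (differential h p)

/-- The defining property of the gradient. -/
theorem inner_grad (h : N → ℝ) (p : N) (v : TangentSpace (𝓡 n) p) :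
    inner ℝ (grad h p) v = differential h p v := by
  have := finiteDimensional_tangentSpace (n := n) p
  have : CompleteSpace (TangentSpace (𝓡 n) p) := FiniteDimensional.complete ℝ _
  exact InnerProductSpace.toDual_symm_apply

/-- The matrix `gᵢⱼ = ⟨∂ᵢ, ∂ⱼ⟩` of the metric in the chart at `p`. -/
def metricMat (p : N) (y : EuclideanSpace ℝ (Fin n)) : Matrix (Fin n) (Fin n) ℝ :=
  Matrix.of fun i j ↦ inner ℝ (coordVec p i y) (coordVec p j y)

/-- The Christoffel symbols `Γᵏᵢⱼ = ½ gᵏˡ (∂ᵢ gⱼₗ + ∂ⱼ gᵢₗ - ∂ₗ gᵢⱼ)` of the Levi-Civita connection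
in the chart at `p`. -/
def christoffel (p : N) (k i j : Fin n) (y : EuclideanSpace ℝ (Fin n)) : ℝ :=
  (1 / 2) * ∑ l, (metricMat p y)⁻¹ k l *
    (pd i (fun z ↦ metricMat p z j l) y + pd j (fun z ↦ metricMat p z i l) y
      - pd l (fun z ↦ metricMat p z i j) y)

/-- The components `Rᵢⱼ = ∂ₖΓᵏᵢⱼ - ∂ᵢΓᵏₖⱼ + ΓᵏₖₗΓˡᵢⱼ - ΓᵏᵢₗΓˡₖⱼ` of the Ricci tensor in the chart
at `p`. -/
def ricciCoord (p : N) (i j : Fin n) (y : EuclideanSpace ℝ (Fin n)) : ℝ :=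
  ∑ k, (pd k (christoffel p k i j) y - pd i (christoffel p k k j) y
    + ∑ l, (christoffel p k k l y * christoffel p l i j y
      - christoffel p k i l y * christoffel p l k j y))

/-- The components `∂ᵢ∂ⱼh - Γᵏᵢⱼ ∂ₖh` of the Hessian `∇²h` in the chart at `p`. -/
def hessCoord (h : N → ℝ) (p : N) (i j : Fin n) (y : EuclideanSpace ℝ (Fin n)) : ℝ :=
  pd₂ h p i j y - ∑ k, christoffel p k i j y * pd k (h ∘ (extChartAt (𝓡 n) p).symm) y

/-- The Ricci tensor at `p`. -/
def ricci (p : N) (v w : TangentSpace (𝓡 n) p) : ℝ :=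
  ∑ i, ∑ j, ricciCoord p i j (extChartAt (𝓡 n) p p) * tangentCoord p v i * tangentCoord p w j

variable (n) in
/-- The scalar curvature `R = gⁱʲ Rᵢⱼ` at `p`. -/
def scalarCurvature (p : N) : ℝ :=
  ∑ i : Fin n, ∑ j : Fin n, (metricMat p (extChartAt (𝓡 n) p p))⁻¹ i j *
    ricciCoord p i j (extChartAt (𝓡 n) p p)

/-- The Hessian `∇²h` at `p`. -/
def hessian (h : N → ℝ) (p : N) (v w : TangentSpace (𝓡 n) p) : ℝ :=
  ∑ i, ∑ j, hessCoord h p i j (extChartAt (𝓡 n) p p) * tangentCoord p v i * tangentCoord p w j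

variable (n) in
/-- The Laplace-Beltrami operator `Δh = gⁱʲ (∇²h)ᵢⱼ`. -/
def laplacian (h : N → ℝ) (p : N) : ℝ :=
  ∑ i : Fin n, ∑ j : Fin n, (metricMat p (extChartAt (𝓡 n) p p))⁻¹ i j *
    hessCoord h p i j (extChartAt (𝓡 n) p p)

variable (n) in
/-- The weighted Laplacian `Δ_f h = Δh - ⟨∇f, ∇h⟩`. -/
def weightedLaplacian (f h : N → ℝ) (p : N) : ℝ :=
  laplacian n h p - inner ℝ (grad (n := n) f p) (grad h p)

variable (n) in
/-- `h` is `f`-harmonic: `Δ_f h = 0` on the whole manifold. -/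
def IsWeightedHarmonic (f h : N → ℝ) : Prop :=
  ∀ p, weightedLaplacian n f h p = 0

variable (n) in
/-- The function `|∇h|²`. -/
def gradSq (h : N → ℝ) (p : N) : ℝ :=
  ‖grad (n := n) h p‖ ^ 2

end RiemGeom

end

open RiemGeom

/-! Write `w = log u`. Harmonicity becomes `Δw = ⟨∇f, ∇w⟩ - F`, and Bochner's formula reads `½ΔF =
|∇²w|² + ⟨∇Δw, ∇w⟩ + Ric(∇w, ∇w)`. Differentiating `⟨∇f, ∇w⟩` along `∇w` produces `∇²f(∇w, ∇w) +
½⟨∇f, ∇F⟩`, so Ricci and the Hessian of `f` appear exactly in the combination bounded by hypothesis.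
The remaining `-⟨∇F, ∇w⟩` is at least `-|∇F| F^{1/2}`, and `|∇²w|² ≥ (Δw)²/n = (⟨∇f, ∇w⟩ - F)²/n`,
where expanding, dropping `⟨∇f, ∇w⟩²` and applying Cauchy-Schwarz gives the terms in `1/n`.

Bochner's formula (`IsCoordMetric.bochner`) is proved by matrix calculus for a metric on an open
subset of `ℝⁿ`. The Hessian endomorphism `A = G⁻¹H` is the covariant derivative of the gradient, and
commuting partial derivatives of the gradient components yields the Ricci term.

The difficulty in returning to the manifold is that the Laplacian at each point is defined in the
chart centred there, while Bochner's formula differentiates the equation for `Δw` in one fixed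
chart. Hence `trace_hessEnd_eq_trace`, chart independence of the Laplacian. It rests on an
expression for `∇²h(∇a, ∇b)` through iterated inner products of gradients, which are intrinsic.
Ricci and the Hessian of `f` are needed only at the centre of the chart. -/

namespace RiemGeom

/-! ### Partial derivatives on `ℝⁿ`. -/

section Calculus

open Filter Topology

variable {n : ℕ} {U : Set (EuclideanSpace ℝ (Fin n))} {y : EuclideanSpace ℝ (Fin n)}
  {a b h : EuclideanSpace ℝ (Fin n) → ℝ}

theorem differentiableAt_of_contDiffOn (hU : IsOpen U) (ha : ContDiffOn ℝ ∞ a U) (hy : y ∈ U) :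
    DifferentiableAt ℝ a y :=
  (ha.differentiableOn (by simp)).differentiableAt (hU.mem_nhds hy)

theorem contDiffOn_pd (hU : IsOpen U) (ha : ContDiffOn ℝ ∞ a U) (i : Fin n) :
    ContDiffOn ℝ ∞ (pd i a) U :=
  (ha.fderiv_of_isOpen hU (m := ∞) (by simp)).clm_apply contDiffOn_const

theorem pd_add (i : Fin n) (ha : DifferentiableAt ℝ a y) (hb : DifferentiableAt ℝ b y) :
    pd i (fun z ↦ a z + b z) y = pd i a y + pd i b y := by
  simp [pd, fderiv_fun_add ha hb]

theorem pd_sub (i : Fin n) (ha : DifferentiableAt ℝ a y) (hb : DifferentiableAt ℝ b y) :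
    pd i (fun z ↦ a z - b z) y = pd i a y - pd i b y := by
  simp [pd, fderiv_fun_sub ha hb]

theorem pd_mul (i : Fin n) (ha : DifferentiableAt ℝ a y) (hb : DifferentiableAt ℝ b y) :
    pd i (fun z ↦ a z * b z) y = pd i a y * b y + a y * pd i b y := by
  simp [pd, fderiv_fun_mul ha hb]
  ring

theorem pd_const_mul (i : Fin n) (c : ℝ) (ha : DifferentiableAt ℝ a y) :
    pd i (fun z ↦ c * a z) y = c * pd i a y := by
  simp [pd, fderiv_const_mul ha c]

theorem pd_const (i : Fin n) (c : ℝ) : pd i (fun _ ↦ c) y = 0 := by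
  simp [pd]

theorem pd_sum {ι : Type*} (s : Finset ι) (i : Fin n) {c : ι → EuclideanSpace ℝ (Fin n) → ℝ}
    (hc : ∀ k ∈ s, DifferentiableAt ℝ (c k) y) :
    pd i (fun z ↦ ∑ k ∈ s, c k z) y = ∑ k ∈ s, pd i (c k) y := by
  simp [pd, fderiv_fun_sum hc]

theorem pd_sum_mul {ι : Type*} (s : Finset ι) (i : Fin n)
    {c d : ι → EuclideanSpace ℝ (Fin n) → ℝ} (hc : ∀ k, DifferentiableAt ℝ (c k) y)
    (hd : ∀ k, DifferentiableAt ℝ (d k) y) :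
    pd i (fun z ↦ ∑ k ∈ s, c k z * d k z) y =
      ∑ k ∈ s, pd i (c k) y * d k y + ∑ k ∈ s, c k y * pd i (d k) y := by
  rw [pd_sum s i fun k _ ↦ (hc k).fun_mul (hd k), ← Finset.sum_add_distrib]
  exact Finset.sum_congr rfl fun k _ ↦ pd_mul i (hc k) (hd k)

theorem pd_congr (hU : IsOpen U) (hy : y ∈ U) (hab : Set.EqOn a b U) (i : Fin n) :
    pd i a y = pd i b y := by
  have : a =ᶠ[𝓝 y] b := eventually_of_mem (hU.mem_nhds hy) hab
  simp [pd, this.fderiv_eq]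

theorem pd_log (i : Fin n) (ha : DifferentiableAt ℝ a y) (h0 : a y ≠ 0) :
    pd i (fun z ↦ Real.log (a z)) y = (a y)⁻¹ * pd i a y := by
  simp [pd, fderiv.log ha h0]

theorem pd_coord (i k : Fin n) :
    pd i (fun z : EuclideanSpace ℝ (Fin n) ↦ z k) y = if k = i then 1 else 0 := by
  have : fderiv ℝ (fun z : EuclideanSpace ℝ (Fin n) ↦ z k) y = EuclideanSpace.proj (𝕜 := ℝ) k :=
    (EuclideanSpace.proj (𝕜 := ℝ) k).hasFDerivAt.fderiv
  rw [pd, this]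
  simp

theorem pd_comm (hU : IsOpen U) (ha : ContDiffOn ℝ ∞ a U) (hy : y ∈ U) (i j : Fin n) :
    pd i (pd j a) y = pd j (pd i a) y := by
  have hat : ContDiffAt ℝ ∞ a y := ha.contDiffAt (hU.mem_nhds hy)
  have hd : DifferentiableAt ℝ (fderiv ℝ a) y :=
    ((ha.fderiv_of_isOpen hU (m := ∞) (by simp)).contDiffAt (hU.mem_nhds hy)).differentiableAt
      (by simp)
  have key : ∀ i j : Fin n, pd i (pd j a) y =
      fderiv ℝ (fderiv ℝ a) y (EuclideanSpace.single i 1) (EuclideanSpace.single j 1) := by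
    intro i j
    have : pd j a = fun z ↦ fderiv ℝ a z (EuclideanSpace.single j 1) := rfl
    rw [this]
    simp only [pd]
    rw [fderiv_clm_apply hd (differentiableAt_const _)]
    simp
  rw [key, key]
  exact (hat.isSymmSndFDerivAt (by
    simpa using WithTop.coe_le_coe.2 (le_top : (2 : ℕ∞) ≤ ⊤))) _ _

theorem contDiffOn_det {m : ℕ} {M : EuclideanSpace ℝ (Fin n) → Matrix (Fin m) (Fin m) ℝ}
    (hM : ∀ i j, ContDiffOn ℝ ∞ (fun z ↦ M z i j) U) :
    ContDiffOn ℝ ∞ (fun z ↦ (M z).det) U := by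
  simp only [Matrix.det_apply']
  exact ContDiffOn.sum fun σ _ ↦ contDiffOn_const.mul (contDiffOn_prod fun i _ ↦ hM _ _)

/-- Cramer's rule: an entry of the inverse is a quotient of determinants, which are polynomial in
the entries. -/
theorem contDiffOn_inv_apply {m : ℕ} {M : EuclideanSpace ℝ (Fin n) → Matrix (Fin m) (Fin m) ℝ}
    (hM : ∀ i j, ContDiffOn ℝ ∞ (fun z ↦ M z i j) U) (h0 : ∀ z ∈ U, (M z).det ≠ 0) (i j : Fin m) :
    ContDiffOn ℝ ∞ (fun z ↦ (M z)⁻¹ i j) U := by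
  have : ∀ z, (M z)⁻¹ i j = ((M z).det)⁻¹ * ((M z).updateRow j (Pi.single i 1)).det := by
    intro z
    simp [Matrix.inv_def, Matrix.adjugate_apply]
  simp only [this]
  refine ((contDiffOn_det hM).inv h0).mul (contDiffOn_det fun k l ↦ ?_)
  by_cases hk : k = j
  · subst hk
    simpa using contDiffOn_const
  · simpa [Matrix.updateRow_ne hk] using hM k l

end Calculus

/-! ### Levi-Civita connection, gradient and Hessian of a metric in coordinates. -/

section CoordinateMetric

open scoped Matrix

variable {n : ℕ}

/-- A smooth Riemannian metric on an open subset of `ℝⁿ`, given by its matrix. -/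
structure IsCoordMetric (G : EuclideanSpace ℝ (Fin n) → Matrix (Fin n) (Fin n) ℝ)
    (U : Set (EuclideanSpace ℝ (Fin n))) : Prop where
  isOpen : IsOpen U
  smooth : ∀ i j, ContDiffOn ℝ ∞ (fun z ↦ G z i j) U
  posDef : ∀ z ∈ U, (G z).PosDef

variable (G : EuclideanSpace ℝ (Fin n) → Matrix (Fin n) (Fin n) ℝ)

/-- The matrix `Γₗ = (Γᵏₗₘ)ₖₘ` of the Levi-Civita connection of a metric on `ℝⁿ`. -/
noncomputable def connMat (l : Fin n) (y : EuclideanSpace ℝ (Fin n)) :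
    Matrix (Fin n) (Fin n) ℝ :=
  Matrix.of fun k m ↦ (1 / 2) * ∑ s, (G y)⁻¹ k s *
    (pd l (fun z ↦ G z m s) y + pd m (fun z ↦ G z l s) y - pd s (fun z ↦ G z l m) y)

/-- The components of the differential. -/
noncomputable def dVec (h : EuclideanSpace ℝ (Fin n) → ℝ) (y : EuclideanSpace ℝ (Fin n)) :
    Fin n → ℝ :=
  fun i ↦ pd i h y

/-- The components of the gradient. -/
noncomputable def gradVec (h : EuclideanSpace ℝ (Fin n) → ℝ) (y : EuclideanSpace ℝ (Fin n)) :
    Fin n → ℝ :=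
  (G y)⁻¹ *ᵥ dVec h y

/-- The inner product `⟨∇a, ∇b⟩`. -/
noncomputable def innerGrad (a b : EuclideanSpace ℝ (Fin n) → ℝ) (y : EuclideanSpace ℝ (Fin n)) :
    ℝ :=
  dVec a y ⬝ᵥ gradVec G b y

/-- The matrix of the Hessian. -/
noncomputable def hessMat (h : EuclideanSpace ℝ (Fin n) → ℝ) (y : EuclideanSpace ℝ (Fin n)) :
    Matrix (Fin n) (Fin n) ℝ :=
  Matrix.of fun i j ↦ pd i (pd j h) y - ∑ k, connMat G i y k j * pd k h y

/-- The matrix of the Hessian, as an endomorphism. -/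
noncomputable def hessEnd (h : EuclideanSpace ℝ (Fin n) → ℝ) (y : EuclideanSpace ℝ (Fin n)) :
    Matrix (Fin n) (Fin n) ℝ :=
  (G y)⁻¹ * hessMat G h y

/-- The components of the Ricci tensor. -/
noncomputable def ricMat (y : EuclideanSpace ℝ (Fin n)) : Matrix (Fin n) (Fin n) ℝ :=
  Matrix.of fun i j ↦ ∑ k, (pd k (fun z ↦ connMat G i z k j) y
    - pd i (fun z ↦ connMat G k z k j) y
    + ∑ l, (connMat G k y k l * connMat G i y l j - connMat G i y k l * connMat G k y l j))

variable {G} {U : Set (EuclideanSpace ℝ (Fin n))} {y : EuclideanSpace ℝ (Fin n)}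
  {a b h : EuclideanSpace ℝ (Fin n) → ℝ}

namespace IsCoordMetric


theorem det_ne_zero (hG : IsCoordMetric G U) (hy : y ∈ U) : (G y).det ≠ 0 :=
  (hG.posDef y hy).det_pos.ne'

theorem isUnit_det (hG : IsCoordMetric G U) (hy : y ∈ U) : IsUnit (G y).det :=
  (hG.det_ne_zero hy).isUnit

theorem transpose_eq (hG : IsCoordMetric G U) (hy : y ∈ U) : (G y)ᵀ = G y := by
  simpa using (hG.posDef y hy).isHermitian.eq

theorem apply_comm (hG : IsCoordMetric G U) (hy : y ∈ U) (i j : Fin n) : G y i j = G y j i :=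
  congrFun (congrFun (hG.transpose_eq hy) j) i

theorem transpose_inv_eq (hG : IsCoordMetric G U) (hy : y ∈ U) : ((G y)⁻¹)ᵀ = (G y)⁻¹ := by
  rw [Matrix.transpose_nonsing_inv, hG.transpose_eq hy]

theorem pd_apply_comm (hG : IsCoordMetric G U) (hy : y ∈ U) (l i j : Fin n) :
    pd l (fun z ↦ G z i j) y = pd l (fun z ↦ G z j i) y :=
  pd_congr hG.isOpen hy (fun _ hz ↦ hG.apply_comm hz i j) l

/-- The connection is torsion free, because `G` is symmetric. -/
theorem connMat_comm (hG : IsCoordMetric G U) (hy : y ∈ U) (k l m : Fin n) :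
    connMat G l y k m = connMat G m y k l := by
  simp only [connMat, Matrix.of_apply]
  congr 1
  refine Finset.sum_congr rfl fun s _ ↦ ?_
  rw [hG.pd_apply_comm hy s l m]
  ring

theorem contDiffOn_inv (hG : IsCoordMetric G U) (i j : Fin n) :
    ContDiffOn ℝ ∞ (fun z ↦ (G z)⁻¹ i j) U :=
  contDiffOn_inv_apply hG.smooth (fun _ hz ↦ hG.det_ne_zero hz) i j

theorem contDiffOn_connMat (hG : IsCoordMetric G U) (l k m : Fin n) :
    ContDiffOn ℝ ∞ (fun z ↦ connMat G l z k m) U := by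
  simp only [connMat, Matrix.of_apply]
  refine contDiffOn_const.mul (ContDiffOn.sum fun s _ ↦ (hG.contDiffOn_inv k s).mul ?_)
  exact ((contDiffOn_pd hG.isOpen (hG.smooth m s) l).add
    (contDiffOn_pd hG.isOpen (hG.smooth l s) m)).sub (contDiffOn_pd hG.isOpen (hG.smooth l m) s)

theorem contDiffOn_gradVec (hG : IsCoordMetric G U) (ha : ContDiffOn ℝ ∞ a U) (k : Fin n) :
    ContDiffOn ℝ ∞ (fun z ↦ gradVec G a z k) U := by
  simp only [gradVec, Matrix.mulVec, dotProduct, dVec]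
  exact ContDiffOn.sum fun s _ ↦ (hG.contDiffOn_inv k s).mul (contDiffOn_pd hG.isOpen ha s)

theorem contDiffOn_innerGrad (hG : IsCoordMetric G U) (ha : ContDiffOn ℝ ∞ a U)
    (hb : ContDiffOn ℝ ∞ b U) : ContDiffOn ℝ ∞ (innerGrad G a b) U := by
  unfold innerGrad dotProduct dVec
  exact ContDiffOn.sum fun s _ ↦ (contDiffOn_pd hG.isOpen ha s).mul (hG.contDiffOn_gradVec hb s)

theorem contDiffOn_hessMat (hG : IsCoordMetric G U) (ha : ContDiffOn ℝ ∞ a U) (i j : Fin n) :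
    ContDiffOn ℝ ∞ (fun z ↦ hessMat G a z i j) U := by
  simp only [hessMat, Matrix.of_apply]
  exact (contDiffOn_pd hG.isOpen (contDiffOn_pd hG.isOpen ha j) i).sub (ContDiffOn.sum fun k _ ↦
    (hG.contDiffOn_connMat i k j).mul (contDiffOn_pd hG.isOpen ha k))

theorem contDiffOn_hessEnd (hG : IsCoordMetric G U) (ha : ContDiffOn ℝ ∞ a U) (i j : Fin n) :
    ContDiffOn ℝ ∞ (fun z ↦ hessEnd G a z i j) U := by
  simp only [hessEnd, Matrix.mul_apply]
  exact ContDiffOn.sum fun k _ ↦ (hG.contDiffOn_inv i k).mul (hG.contDiffOn_hessMat ha k j)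

theorem innerGrad_comm (hG : IsCoordMetric G U) (hy : y ∈ U) :
    innerGrad G a b y = innerGrad G b a y := by
  simp only [innerGrad, gradVec]
  rw [Matrix.dotProduct_mulVec, dotProduct_comm, ← Matrix.mulVec_transpose,
    hG.transpose_inv_eq hy]

theorem transpose_hessMat (hG : IsCoordMetric G U) (ha : ContDiffOn ℝ ∞ a U) (hy : y ∈ U) :
    (hessMat G a y)ᵀ = hessMat G a y := by
  ext i j
  simp only [Matrix.transpose_apply, hessMat, Matrix.of_apply]
  rw [pd_comm hG.isOpen ha hy]
  simp only [hG.connMat_comm hy _ j i]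

theorem mul_connMat (hG : IsCoordMetric G U) (hy : y ∈ U) (l s m : Fin n) :
    (G y * connMat G l y) s m = (1 / 2) * (pd l (fun z ↦ G z m s) y + pd m (fun z ↦ G z l s) y
      - pd s (fun z ↦ G z l m) y) := by
  set c : Matrix (Fin n) (Fin n) ℝ := Matrix.of fun s m ↦ (1 / 2) *
    (pd l (fun z ↦ G z m s) y + pd m (fun z ↦ G z l s) y - pd s (fun z ↦ G z l m) y) with hc
  have h1 : connMat G l y = (G y)⁻¹ * c := by
    ext k m
    simp only [connMat, Matrix.of_apply, Matrix.mul_apply, hc, Finset.mul_sum]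
    exact Finset.sum_congr rfl fun s _ ↦ by ring
  rw [h1, Matrix.mul_nonsing_inv_cancel_left _ _ (hG.isUnit_det hy)]
  rfl

/-- Metric compatibility of the Levi-Civita connection. -/
theorem pd_metric (hG : IsCoordMetric G U) (hy : y ∈ U) (l : Fin n) :
    Matrix.of (fun i j ↦ pd l (fun z ↦ G z i j) y) =
      (connMat G l y)ᵀ * G y + G y * connMat G l y := by
  ext i j
  have h1 : ((connMat G l y)ᵀ * G y) i j = (G y * connMat G l y) j i := by
    conv_lhs => rw [← hG.transpose_eq hy]
    rw [← Matrix.transpose_mul, Matrix.transpose_apply]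
  rw [Matrix.add_apply, h1, hG.mul_connMat hy, hG.mul_connMat hy, hG.pd_apply_comm hy l j i,
    hG.pd_apply_comm hy i l j, hG.pd_apply_comm hy j l i, hG.pd_apply_comm hy i j l,
    hG.pd_apply_comm hy j i l, Matrix.of_apply]
  ring

/-- Differentiate `G G⁻¹ = 1` and insert metric compatibility. -/
theorem pd_inv (hG : IsCoordMetric G U) (hy : y ∈ U) (l : Fin n) :
    Matrix.of (fun i j ↦ pd l (fun z ↦ (G z)⁻¹ i j) y) =
      -(connMat G l y * (G y)⁻¹ + (G y)⁻¹ * (connMat G l y)ᵀ) := by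
  have h1 : Matrix.of (fun i j ↦ pd l (fun z ↦ G z i j) y) * (G y)⁻¹ +
      G y * Matrix.of (fun i j ↦ pd l (fun z ↦ (G z)⁻¹ i j) y) = 0 := by
    ext i j
    have h2 : pd l (fun z ↦ ∑ k, G z i k * (G z)⁻¹ k j) y = 0 := by
      rw [pd_congr (b := fun _ ↦ (1 : Matrix (Fin n) (Fin n) ℝ) i j) hG.isOpen hy, pd_const]
      intro z hz
      simp only [← Matrix.mul_apply]
      rw [Matrix.mul_nonsing_inv _ (hG.isUnit_det hz)]
    have hd1 := fun i k ↦ differentiableAt_of_contDiffOn hG.isOpen (hG.smooth i k) hy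
    have hd2 := fun i k ↦ differentiableAt_of_contDiffOn hG.isOpen (hG.contDiffOn_inv i k) hy
    rw [pd_sum_mul _ _ (hd1 i) fun k ↦ hd2 k j] at h2
    simpa [Matrix.mul_apply] using h2
  have h3 := congrArg (fun M ↦ (G y)⁻¹ * M) h1
  simp only [hG.pd_metric hy, Matrix.mul_add, Matrix.add_mul, Matrix.mul_zero,
    Matrix.mul_assoc, Matrix.nonsing_inv_mul_cancel_left _ _ (hG.isUnit_det hy),
    Matrix.mul_nonsing_inv _ (hG.isUnit_det hy), Matrix.mul_one] at h3
  rw [eq_neg_iff_add_eq_zero, ← h3]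
  abel

/-- Says that `hessEnd` is the covariant derivative of the gradient. Of the two connection terms in
`∂G⁻¹`, one cancels the Christoffel term of the Hessian and the other remains. -/
theorem pd_gradVec (hG : IsCoordMetric G U) (ha : ContDiffOn ℝ ∞ a U) (hy : y ∈ U)
    (l k : Fin n) :
    pd l (fun z ↦ gradVec G a z k) y =
      hessEnd G a y k l - (connMat G l y *ᵥ gradVec G a y) k := by
  have hd1 := fun i k ↦ differentiableAt_of_contDiffOn hG.isOpen (hG.contDiffOn_inv i k) hy
  have hd2 := fun i ↦ differentiableAt_of_contDiffOn hG.isOpen (contDiffOn_pd hG.isOpen ha i) hy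
  have h1 : pd l (fun z ↦ gradVec G a z k) y =
      (Matrix.of (fun i j ↦ pd l (fun z ↦ (G z)⁻¹ i j) y) *ᵥ dVec a y
        + (G y)⁻¹ *ᵥ fun j ↦ pd l (pd j a) y) k := by
    simp only [gradVec, Matrix.mulVec, dotProduct, dVec, Pi.add_apply]
    rw [pd_sum_mul _ _ (hd1 k) hd2]
    rfl
  have h2 : (fun j ↦ pd l (pd j a) y) = (hessMat G a y)ᵀ.col l + (connMat G l y)ᵀ *ᵥ dVec a y := by
    ext j
    simp [hessMat, Matrix.mulVec, dotProduct, dVec, Matrix.col]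
  have h3 : hessEnd G a y k l = ((G y)⁻¹ *ᵥ (hessMat G a y)ᵀ.col l) k := by
    rw [hG.transpose_hessMat ha hy]
    simp [hessEnd, Matrix.mul_apply, Matrix.mulVec, dotProduct, Matrix.col]
  rw [h1, h2, h3, hG.pd_inv hy, Matrix.mulVec_add, Matrix.neg_mulVec, Matrix.add_mulVec]
  simp only [gradVec, Matrix.mulVec_mulVec, Pi.add_apply, Pi.neg_apply]
  ring

/-- Leibniz rule for the metric connection: the Christoffel terms from differentiating `da` and `∇b`
cancel. -/
theorem pd_innerGrad (hG : IsCoordMetric G U) (ha : ContDiffOn ℝ ∞ a U)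
    (hb : ContDiffOn ℝ ∞ b U) (hy : y ∈ U) (j : Fin n) :
    pd j (innerGrad G a b) y =
      (hessMat G a y *ᵥ gradVec G b y) j + (hessMat G b y *ᵥ gradVec G a y) j := by
  have hd1 := fun i ↦ differentiableAt_of_contDiffOn hG.isOpen (contDiffOn_pd hG.isOpen ha i) hy
  have hd2 := fun i ↦ differentiableAt_of_contDiffOn hG.isOpen (hG.contDiffOn_gradVec hb i) hy
  have h1 : pd j (innerGrad G a b) y =
      (fun k ↦ pd j (pd k a) y) ⬝ᵥ gradVec G b y +
        dVec a y ⬝ᵥ fun k ↦ pd j (fun z ↦ gradVec G b z k) y := by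
    unfold innerGrad dotProduct dVec
    rw [pd_sum_mul _ _ hd1 hd2]
  have h2 : (fun k ↦ pd j (pd k a) y) = hessMat G a y j + dVec a y ᵥ* connMat G j y := by
    ext k
    simp [hessMat, Matrix.vecMul, dotProduct, dVec, mul_comm]
  have h3 : (fun k ↦ pd j (fun z ↦ gradVec G b z k) y) =
      (hessEnd G b y).col j - connMat G j y *ᵥ gradVec G b y := by
    ext k
    exact hG.pd_gradVec hb hy j k
  have h4 : dVec a y ⬝ᵥ (hessEnd G b y).col j = (hessMat G b y *ᵥ gradVec G a y) j := by
    have : (hessEnd G b y).col j = (G y)⁻¹ *ᵥ hessMat G b y j := by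
      ext k
      conv_rhs => rw [← hG.transpose_hessMat hb hy]
      simp [hessEnd, Matrix.mul_apply, Matrix.mulVec, dotProduct, Matrix.col]
    rw [this, Matrix.dotProduct_mulVec, ← Matrix.mulVec_transpose, hG.transpose_inv_eq hy,
      dotProduct_comm]
    rfl
  rw [h1, h2, h3, add_dotProduct, dotProduct_sub, h4, ← Matrix.dotProduct_mulVec]
  simp only [Matrix.mulVec]
  ring

/-- The Hessian is determined by the inner products of gradients. -/
theorem hessMat_gradVec_gradVec (hG : IsCoordMetric G U) (hh : ContDiffOn ℝ ∞ h U)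
    (ha : ContDiffOn ℝ ∞ a U) (hb : ContDiffOn ℝ ∞ b U) (hy : y ∈ U) :
    2 * (gradVec G a y ⬝ᵥ hessMat G h y *ᵥ gradVec G b y) =
      innerGrad G a (innerGrad G h b) y + innerGrad G b (innerGrad G h a) y
        - innerGrad G h (innerGrad G a b) y := by
  have key : ∀ {c d e : EuclideanSpace ℝ (Fin n) → ℝ}, ContDiffOn ℝ ∞ d U → ContDiffOn ℝ ∞ e U →
      innerGrad G c (innerGrad G d e) y =
        gradVec G c y ⬝ᵥ hessMat G d y *ᵥ gradVec G e y +
          gradVec G c y ⬝ᵥ hessMat G e y *ᵥ gradVec G d y := by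
    intro c d e hd he
    rw [hG.innerGrad_comm hy, innerGrad, ← dotProduct_add, dotProduct_comm]
    congr 1
    ext j
    exact hG.pd_innerGrad hd he hy j
  have sym : ∀ {d : EuclideanSpace ℝ (Fin n) → ℝ} (v w : Fin n → ℝ), ContDiffOn ℝ ∞ d U →
      v ⬝ᵥ hessMat G d y *ᵥ w = w ⬝ᵥ hessMat G d y *ᵥ v := by
    intro d v w hd
    rw [Matrix.dotProduct_mulVec, dotProduct_comm, ← Matrix.mulVec_transpose,
      hG.transpose_hessMat hd hy]
  -- Of the six Hessian terms, those of `a` and `b` cancel by symmetry; two equal terms in `h`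
  -- remain.
  rw [key hh hb, key hh ha, key ha hb, sym (gradVec G b y) (gradVec G a y) hh,
    sym (gradVec G h y) (gradVec G b y) ha, sym (gradVec G h y) (gradVec G a y) hb]
  ring

end IsCoordMetric

end CoordinateMetric

/-! ### Bochner's formula and the trace inequality. -/

section Bochner

open scoped Matrix MatrixOrder

variable {n : ℕ} {G : EuclideanSpace ℝ (Fin n) → Matrix (Fin n) (Fin n) ℝ}
  {U : Set (EuclideanSpace ℝ (Fin n))} {y : EuclideanSpace ℝ (Fin n)}
  {a f w : EuclideanSpace ℝ (Fin n) → ℝ}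

namespace IsCoordMetric

/-- Differentiates `A = ∂V + ΓV`, with `V` the gradient. The part `∂∂V` is symmetric in `i` and `j`;
the `∂Γ` and `ΓΓ` parts will assemble into curvature. -/
theorem pd_hessEnd (hG : IsCoordMetric G U) (ha : ContDiffOn ℝ ∞ a U) (hy : y ∈ U)
    (i j k : Fin n) :
    pd i (fun z ↦ hessEnd G a z k j) y = pd i (pd j (fun z ↦ gradVec G a z k)) y
      + ∑ m, pd i (fun z ↦ connMat G j z k m) y * gradVec G a y m
      + (∑ m, connMat G j y k m * hessEnd G a y m i
        - ((connMat G j y * connMat G i y) *ᵥ gradVec G a y) k) := by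
  have hV := hG.contDiffOn_gradVec ha
  have hdV := fun m ↦ differentiableAt_of_contDiffOn hG.isOpen (hV m) hy
  have hdΓ := fun m ↦ differentiableAt_of_contDiffOn hG.isOpen (hG.contDiffOn_connMat j k m) hy
  have hdd := differentiableAt_of_contDiffOn hG.isOpen (contDiffOn_pd hG.isOpen (hV k) j) hy
  have h1 : pd i (fun z ↦ hessEnd G a z k j) y = pd i (fun z ↦
      pd j (fun z ↦ gradVec G a z k) z + ∑ m, connMat G j z k m * gradVec G a z m) y := by
    refine pd_congr hG.isOpen hy (fun z hz ↦ ?_) i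
    rw [hG.pd_gradVec ha hz]
    simp [Matrix.mulVec, dotProduct]
  rw [h1, pd_add i hdd (DifferentiableAt.fun_sum fun m _ ↦ (hdΓ m).fun_mul (hdV m)),
    pd_sum_mul _ _ hdΓ hdV, ← add_assoc]
  congr 1
  simp only [hG.pd_gradVec ha hy, mul_sub, Finset.sum_sub_distrib, ← Matrix.mulVec_mulVec]
  rfl

/-- The contracted Ricci identity for the Hessian. -/
theorem sum_pd_hessEnd (hG : IsCoordMetric G U) (ha : ContDiffOn ℝ ∞ a U) (hy : y ∈ U)
    (j : Fin n) :
    ∑ k, pd k (fun z ↦ hessEnd G a z k j) y = pd j (fun z ↦ (hessEnd G a z).trace) y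
      + (ricMat G y *ᵥ gradVec G a y) j
      + ∑ k, ∑ m, connMat G j y k m * hessEnd G a y m k
      - ∑ k, ∑ m, connMat G k y k m * hessEnd G a y m j := by
  have h1 : pd j (fun z ↦ (hessEnd G a z).trace) y = ∑ k, pd j (fun z ↦ hessEnd G a z k k) y := by
    simp only [Matrix.trace, Matrix.diag]
    exact pd_sum _ _ fun k _ ↦
      differentiableAt_of_contDiffOn hG.isOpen (hG.contDiffOn_hessEnd ha k k) hy
  have h2 : (ricMat G y *ᵥ gradVec G a y) j = ∑ k, (
      ∑ m, pd k (fun z ↦ connMat G j z k m) y * gradVec G a y m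
      - ∑ m, pd j (fun z ↦ connMat G k z k m) y * gradVec G a y m
      + ((connMat G k y * connMat G j y) *ᵥ gradVec G a y) k
      - ((connMat G j y * connMat G k y) *ᵥ gradVec G a y) k) := by
    simp only [Matrix.mulVec, dotProduct, ricMat, Matrix.of_apply, Finset.sum_mul, Matrix.mul_apply]
    rw [Finset.sum_comm]
    refine Finset.sum_congr rfl fun k _ ↦ ?_
    rw [← Finset.sum_sub_distrib, ← Finset.sum_add_distrib, ← Finset.sum_sub_distrib]
    refine Finset.sum_congr rfl fun m _ ↦ ?_
    simp only [← Finset.sum_mul, Finset.sum_sub_distrib]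
    ring
  rw [h1, h2, ← Finset.sum_add_distrib, ← Finset.sum_add_distrib, ← Finset.sum_sub_distrib]
  refine Finset.sum_congr rfl fun k _ ↦ ?_
  rw [hG.pd_hessEnd ha hy, hG.pd_hessEnd ha hy, pd_comm hG.isOpen (hG.contDiffOn_gradVec ha k) hy]
  ring

theorem gradVec_innerGrad_self (hG : IsCoordMetric G U) (hw : ContDiffOn ℝ ∞ w U) (hy : y ∈ U) :
    gradVec G (innerGrad G w w) y = (2 : ℝ) • (hessEnd G w y *ᵥ gradVec G w y) := by
  have : dVec (innerGrad G w w) y = (2 : ℝ) • (hessMat G w y *ᵥ gradVec G w y) := by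
    ext j
    rw [dVec, hG.pd_innerGrad hw hw hy]
    simp
    ring
  conv_lhs => rw [gradVec, this, Matrix.mulVec_smul, Matrix.mulVec_mulVec]
  rfl

/-- **Bochner's formula** in coordinates. -/
theorem bochner (hG : IsCoordMetric G U) (hw : ContDiffOn ℝ ∞ w U) (hy : y ∈ U) :
    (1 / 2) * (hessEnd G (innerGrad G w w) y).trace =
      (hessEnd G w y * hessEnd G w y).trace
        + innerGrad G (fun z ↦ (hessEnd G w z).trace) w y
        + gradVec G w y ⬝ᵥ ricMat G y *ᵥ gradVec G w y := by
  have hdV := fun m ↦ differentiableAt_of_contDiffOn hG.isOpen (hG.contDiffOn_gradVec hw m) hy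
  have hdA := fun k j ↦
    differentiableAt_of_contDiffOn hG.isOpen (hG.contDiffOn_hessEnd hw k j) hy
  -- `∇|∇w|² = 2AV`, so the diagonal entries are those of the covariant derivative of `2AV`.
  have h1 : ∀ k, hessEnd G (innerGrad G w w) y k k = 2 * (
      ∑ j, pd k (fun z ↦ hessEnd G w z k j) y * gradVec G w y j
      + (∑ j, hessEnd G w y k j * hessEnd G w y j k
        - ∑ j, ∑ m, hessEnd G w y k j * (connMat G k y j m * gradVec G w y m))
      + ∑ m, ∑ j, connMat G k y k m * (hessEnd G w y m j * gradVec G w y j)) := by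
    intro k
    have h2 := hG.pd_gradVec (hG.contDiffOn_innerGrad hw hw) hy k k
    rw [eq_comm, sub_eq_iff_eq_add] at h2
    have h3 : pd k (fun z ↦ gradVec G (innerGrad G w w) z k) y =
        pd k (fun z ↦ 2 * ∑ j, hessEnd G w z k j * gradVec G w z j) y := by
      refine pd_congr hG.isOpen hy (fun z hz ↦ ?_) k
      rw [hG.gradVec_innerGrad_self hw hz]
      rfl
    rw [h2, h3, pd_const_mul _ _ (DifferentiableAt.fun_sum fun m _ ↦ (hdA k m).fun_mul (hdV m)),
      pd_sum_mul _ _ (hdA k) hdV, hG.gradVec_innerGrad_self hw hy, Matrix.mulVec_smul]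
    simp only [hG.pd_gradVec hw hy, Pi.smul_apply, smul_eq_mul, Matrix.mulVec, dotProduct,
      mul_sub, Finset.sum_sub_distrib]
    simp only [← Finset.mul_sum]
    ring
  have h4 : ∑ k, ∑ j, pd k (fun z ↦ hessEnd G w z k j) y * gradVec G w y j =
      ∑ j, (pd j (fun z ↦ (hessEnd G w z).trace) y * gradVec G w y j
        + gradVec G w y j * (ricMat G y *ᵥ gradVec G w y) j
        + (∑ k, ∑ m, connMat G j y k m * hessEnd G w y m k) * gradVec G w y j
        - (∑ k, ∑ m, connMat G k y k m * hessEnd G w y m j) * gradVec G w y j) := by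
    rw [Finset.sum_comm]
    refine Finset.sum_congr rfl fun j _ ↦ ?_
    rw [← Finset.sum_mul, hG.sum_pd_hessEnd hw hy]
    ring
  -- By torsion-freeness this connection term of the Ricci identity cancels the one coming from
  -- `∂V`; `h6` matches the other with the divergence of `AV`.
  have h5 : ∑ j, (∑ k, ∑ m, connMat G j y k m * hessEnd G w y m k) * gradVec G w y j =
      ∑ k, ∑ j, ∑ m, hessEnd G w y k j * (connMat G k y j m * gradVec G w y m) := by
    simp only [Finset.sum_mul]
    rw [Finset.sum_comm]
    conv_rhs => rw [Finset.sum_comm]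
    refine Finset.sum_congr rfl fun k _ ↦ ?_
    rw [Finset.sum_comm]
    refine Finset.sum_congr rfl fun m _ ↦ Finset.sum_congr rfl fun j _ ↦ ?_
    rw [hG.connMat_comm hy]
    ring
  have h6 : ∑ j, (∑ k, ∑ m, connMat G k y k m * hessEnd G w y m j) * gradVec G w y j =
      ∑ k, ∑ m, ∑ j, connMat G k y k m * (hessEnd G w y m j * gradVec G w y j) := by
    simp only [Finset.sum_mul]
    rw [Finset.sum_comm]
    refine Finset.sum_congr rfl fun k _ ↦ ?_
    rw [Finset.sum_comm]
    exact Finset.sum_congr rfl fun m _ ↦ Finset.sum_congr rfl fun j _ ↦ by ring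
  have h7 : (hessEnd G (innerGrad G w w) y).trace =
      ∑ k, hessEnd G (innerGrad G w w) y k k := rfl
  have h8 : (hessEnd G w y * hessEnd G w y).trace =
      ∑ k, ∑ j, hessEnd G w y k j * hessEnd G w y j k := by
    simp [Matrix.trace, Matrix.mul_apply]
  rw [h7, Finset.sum_congr rfl fun k _ ↦ h1 k, ← Finset.mul_sum, Finset.sum_add_distrib,
    Finset.sum_add_distrib, h4, Finset.sum_sub_distrib, Finset.sum_sub_distrib,
    Finset.sum_add_distrib, Finset.sum_add_distrib, h5, h6, h8]
  simp only [innerGrad, dVec, dotProduct]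
  ring

/-- The product rule `⟨∇⟨∇f, ∇w⟩, ∇w⟩ = ∇²f(∇w, ∇w) + ½ ⟨∇f, ∇|∇w|²⟩`. -/
theorem innerGrad_innerGrad (hG : IsCoordMetric G U) (hf : ContDiffOn ℝ ∞ f U)
    (hw : ContDiffOn ℝ ∞ w U) (hy : y ∈ U) :
    innerGrad G (innerGrad G f w) w y = gradVec G w y ⬝ᵥ hessMat G f y *ᵥ gradVec G w y
      + (1 / 2) * innerGrad G f (innerGrad G w w) y := by
  have h1 := hG.hessMat_gradVec_gradVec hf hw hw hy
  rw [hG.innerGrad_comm hy (a := innerGrad G f w)]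
  linarith

end IsCoordMetric

/-- For symmetric `H` and positive definite `P`, `(tr PH)² ≤ n tr (PH)²`. -/
theorem sq_trace_mul_le {P H : Matrix (Fin n) (Fin n) ℝ} (hP : P.PosDef) (hH : Hᵀ = H)
    (hn : 0 < n) : (1 / (n : ℝ)) * (P * H).trace ^ 2 ≤ (P * H * (P * H)).trace := by
  have key : ∀ K : Matrix (Fin n) (Fin n) ℝ, Kᵀ = K → 0 ≤ (P * K * (P * K)).trace := by
    intro K hK
    -- With `P = B*B` the trace is the squared Frobenius norm of the symmetric matrix `B K B*`.
    obtain ⟨B, rfl⟩ := CStarAlgebra.nonneg_iff_eq_star_mul_self.mp hP.posSemidef.nonneg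
    have h1 : (star B * B * K * (star B * B * K)).trace =
        ((B * K * star B)ᵀ * (B * K * star B)).trace := by
      have : (B * K * star B)ᵀ = B * K * star B := by
        simp [Matrix.star_eq_conjTranspose, Matrix.transpose_mul, hK, Matrix.mul_assoc]
      rw [this]
      simp only [Matrix.mul_assoc]
      rw [Matrix.trace_mul_comm]
      simp only [Matrix.mul_assoc]
    rw [h1]
    simpa using (Matrix.posSemidef_conjTranspose_mul_self (B * K * star B)).trace_nonneg
  have hPd : IsUnit P.det := hP.det_pos.ne'.isUnit
  set t := (P * H).trace with ht
  have hn' : (n : ℝ) ≠ 0 := by positivity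
  -- The trace-free part of `H`: for `P = G⁻¹`, the matrix `P⁻¹` is the metric.
  have h2 := key (H - (t / n) • P⁻¹) (by
    have : Pᵀ = P := by simpa using hP.isHermitian.eq
    rw [Matrix.transpose_sub, Matrix.transpose_smul, Matrix.transpose_nonsing_inv, hH, this])
  rw [Matrix.mul_sub, Matrix.mul_smul, Matrix.mul_nonsing_inv _ hPd] at h2
  simp only [Matrix.sub_mul, Matrix.mul_sub, Matrix.smul_mul, Matrix.mul_smul, Matrix.mul_one,
    Matrix.one_mul, Matrix.trace_sub, Matrix.trace_smul, Matrix.trace_one, Fintype.card_fin,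
    smul_eq_mul, ← ht] at h2
  have h3 : (P * H * (P * H)).trace - t / n * t - (t / n * t - t / n * (t / n * n)) =
      (P * H * (P * H)).trace - 1 / n * t ^ 2 := by
    field_simp
    ring
  linarith

end Bochner

/-! ### The logarithm of a nonvanishing function. -/

section Log

open scoped Matrix

variable {n : ℕ} {G : EuclideanSpace ℝ (Fin n) → Matrix (Fin n) (Fin n) ℝ}
  {U V : Set (EuclideanSpace ℝ (Fin n))} {y : EuclideanSpace ℝ (Fin n)}
  {a b u : EuclideanSpace ℝ (Fin n) → ℝ}

theorem dVec_congr (hU : IsOpen U) (hy : y ∈ U) (hab : Set.EqOn a b U) : dVec a y = dVec b y :=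
  funext fun i ↦ pd_congr hU hy hab i

theorem hessMat_congr (hU : IsOpen U) (hy : y ∈ U) (hab : Set.EqOn a b U) :
    hessMat G a y = hessMat G b y := by
  ext i j
  have h1 : pd i (pd j a) y = pd i (pd j b) y :=
    pd_congr hU hy (fun z hz ↦ pd_congr hU hz hab j) i
  simp only [hessMat, Matrix.of_apply, h1, pd_congr hU hy hab]

namespace IsCoordMetric

theorem mono (hG : IsCoordMetric G U) (hV : IsOpen V) (h : V ⊆ U) : IsCoordMetric G V :=
  ⟨hV, fun i j ↦ (hG.smooth i j).mono h, fun z hz ↦ hG.posDef z (h hz)⟩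

theorem dVec_eq_smul_dVec_log (hG : IsCoordMetric G U) (hu : ContDiffOn ℝ ∞ u U)
    (h0 : ∀ z ∈ U, u z ≠ 0) (hy : y ∈ U) :
    dVec u y = u y • dVec (fun z ↦ Real.log (u z)) y := by
  ext i
  simp only [dVec, Pi.smul_apply, smul_eq_mul]
  rw [pd_log i (differentiableAt_of_contDiffOn hG.isOpen hu hy) (h0 y hy),
    mul_inv_cancel_left₀ (h0 y hy)]

/-- Comes from `∇²u = u (∇²w + dw ⊗ dw)` with `w = log u`; the rank-one term has trace `|∇w|²`. -/
theorem trace_hessEnd_eq_log (hG : IsCoordMetric G U) (hu : ContDiffOn ℝ ∞ u U)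
    (h0 : ∀ z ∈ U, u z ≠ 0) (hy : y ∈ U) :
    (hessEnd G u y).trace = u y * ((hessEnd G (fun z ↦ Real.log (u z)) y).trace
      + innerGrad G (fun z ↦ Real.log (u z)) (fun z ↦ Real.log (u z)) y) := by
  set w : EuclideanSpace ℝ (Fin n) → ℝ := fun z ↦ Real.log (u z) with hw
  have hws : ContDiffOn ℝ ∞ w U := hu.log h0
  have hd : ∀ z ∈ U, ∀ j, pd j u z = u z * pd j w z := fun z hz j ↦
    congrFun (hG.dVec_eq_smul_dVec_log hu h0 hz) j
  have h1 : hessMat G u y = u y • (hessMat G w y + Matrix.vecMulVec (dVec w y) (dVec w y)) := by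
    ext i j
    have h2 : pd i (pd j u) y = pd i u y * pd j w y + u y * pd i (pd j w) y := by
      rw [← pd_mul i (differentiableAt_of_contDiffOn hG.isOpen hu hy)
        (differentiableAt_of_contDiffOn hG.isOpen (contDiffOn_pd hG.isOpen hws j) hy)]
      exact pd_congr hG.isOpen hy (fun z hz ↦ hd z hz j) i
    simp only [hessMat, Matrix.of_apply, h2, hd y hy, Matrix.smul_apply, Matrix.add_apply,
      Matrix.vecMulVec_apply, smul_eq_mul, dVec, mul_left_comm _ (u y), ← Finset.mul_sum]
    ring
  rw [hessEnd, h1, Matrix.mul_smul, Matrix.trace_smul, Matrix.mul_add, Matrix.trace_add,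
    Matrix.mul_vecMulVec, Matrix.trace_vecMulVec, dotProduct_comm]
  rfl

end IsCoordMetric

end Log

/-! ### Reading the metric and gradients of the manifold in a chart. -/

section Chart

open scoped Matrix

variable {n : ℕ} {N : Type*} [TopologicalSpace N] [ChartedSpace (EuclideanSpace ℝ (Fin n)) N]
  [IsManifold (𝓡 n) ∞ N]

theorem mdifferentiableAt_extChartAt_symm' {p : N} {y : EuclideanSpace ℝ (Fin n)}
    (hy : y ∈ (extChartAt (𝓡 n) p).target) :
    MDifferentiableAt 𝓘(ℝ, EuclideanSpace ℝ (Fin n)) (𝓡 n) (extChartAt (𝓡 n) p).symm y := by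
  have := IsManifold.of_le (I := 𝓡 n) (M := N) (m := 1) (n := ∞) (by simp)
  have h := mdifferentiableWithinAt_extChartAt_symm hy
  rwa [ModelWithCorners.range_eq_univ, mdifferentiableWithinAt_univ] at h

theorem differential_coordVec {p : N} {y : EuclideanSpace ℝ (Fin n)} {h : N → ℝ}
    (hy : y ∈ (extChartAt (𝓡 n) p).target)
    (hh : MDifferentiableAt (𝓡 n) 𝓘(ℝ, ℝ) h ((extChartAt (𝓡 n) p).symm y)) (i : Fin n) :
    differential h ((extChartAt (𝓡 n) p).symm y) (coordVec p i y) =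
      pd i (h ∘ (extChartAt (𝓡 n) p).symm) y := by
  have h1 := mvfderiv_comp_apply y hh (mdifferentiableAt_extChartAt_symm' hy)
    (EuclideanSpace.single i (1 : ℝ) : EuclideanSpace ℝ (Fin n))
  rw [differential, coordVec, ← h1, pd, mvfderiv, mfderiv_eq_fderiv]
  rfl

theorem linearIndependent_coordVec {p : N} {y : EuclideanSpace ℝ (Fin n)}
    (hy : y ∈ (extChartAt (𝓡 n) p).target) :
    LinearIndependent ℝ (fun i ↦ coordVec p i y) := by
  have := IsManifold.of_le (I := 𝓡 n) (M := N) (m := 1) (n := ∞) (by simp)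
  have h1 := isInvertible_mfderivWithin_extChartAt_symm hy
  rw [ModelWithCorners.range_eq_univ, mfderivWithin_univ] at h1
  have h2 := (EuclideanSpace.basisFun (Fin n) ℝ).toBasis.linearIndependent.map_injOn
    (mfderiv 𝓘(ℝ, EuclideanSpace ℝ (Fin n)) (𝓡 n) (extChartAt (𝓡 n) p).symm y).toLinearMap
    h1.injective.injOn
  have h3 : (fun i ↦ coordVec p i y) =
      (mfderiv 𝓘(ℝ, EuclideanSpace ℝ (Fin n)) (𝓡 n) (extChartAt (𝓡 n) p).symm y).toLinearMap ∘
        (EuclideanSpace.basisFun (Fin n) ℝ).toBasis := by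
    funext i
    have h4 : (EuclideanSpace.basisFun (Fin n) ℝ).toBasis i = EuclideanSpace.single i (1 : ℝ) := by
      simp
    exact congrArg
      (mfderiv 𝓘(ℝ, EuclideanSpace ℝ (Fin n)) (𝓡 n) (extChartAt (𝓡 n) p).symm y) h4.symm
  rw [h3]
  exact h2

variable [RiemannianBundle (fun x : N ↦ TangentSpace (𝓡 n) x)]

theorem posDef_metricMat {p : N} {y : EuclideanSpace ℝ (Fin n)}
    (hy : y ∈ (extChartAt (𝓡 n) p).target) : (metricMat p y).PosDef :=
  Matrix.posDef_gram_of_linearIndependent (linearIndependent_coordVec hy)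

/-- The coordinate vectors form a basis, by counting dimensions. Pairing an expansion of the Riesz
gradient with them gives `G c = dh`. -/
theorem grad_eq_sum {p : N} {y : EuclideanSpace ℝ (Fin n)} {h : N → ℝ}
    (hy : y ∈ (extChartAt (𝓡 n) p).target)
    (hh : MDifferentiableAt (𝓡 n) 𝓘(ℝ, ℝ) h ((extChartAt (𝓡 n) p).symm y)) :
    grad h ((extChartAt (𝓡 n) p).symm y) =
      ∑ j, gradVec (metricMat p) (h ∘ (extChartAt (𝓡 n) p).symm) y j • coordVec p j y := by
  have := finiteDimensional_tangentSpace (n := n) ((extChartAt (𝓡 n) p).symm y)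
  have hcard : Fintype.card (Fin n) =
      Module.finrank ℝ (TangentSpace (𝓡 n) ((extChartAt (𝓡 n) p).symm y)) := by
    rw [Fintype.card_fin]
    exact (finrank_euclideanSpace_fin (𝕜 := ℝ) (n := n)).symm
  have hspan := (linearIndependent_coordVec hy).span_eq_top_of_card_eq_finrank' hcard
  obtain ⟨c, hc⟩ : ∃ c : Fin n → ℝ,
      ∑ j, c j • coordVec p j y = grad h ((extChartAt (𝓡 n) p).symm y) :=
    (Submodule.mem_span_range_iff_exists_fun ℝ).1 (hspan ▸ Submodule.mem_top)
  have h1 : metricMat p y *ᵥ c = dVec (h ∘ (extChartAt (𝓡 n) p).symm) y := by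
    ext i
    rw [dVec, ← differential_coordVec hy hh, ← inner_grad, ← hc, sum_inner]
    simp only [Matrix.mulVec, dotProduct, metricMat, Matrix.of_apply, real_inner_smul_left]
    exact Finset.sum_congr rfl fun j _ ↦ by rw [real_inner_comm, mul_comm]
  have h2 : gradVec (metricMat p) (h ∘ (extChartAt (𝓡 n) p).symm) y = c := by
    rw [gradVec, ← h1, Matrix.mulVec_mulVec,
      Matrix.nonsing_inv_mul _ (posDef_metricMat hy).det_pos.ne'.isUnit, Matrix.one_mulVec]
  rw [h2, hc]

theorem differential_grad {p : N} {y : EuclideanSpace ℝ (Fin n)} {a b : N → ℝ}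
    (hy : y ∈ (extChartAt (𝓡 n) p).target)
    (ha : MDifferentiableAt (𝓡 n) 𝓘(ℝ, ℝ) a ((extChartAt (𝓡 n) p).symm y))
    (hb : MDifferentiableAt (𝓡 n) 𝓘(ℝ, ℝ) b ((extChartAt (𝓡 n) p).symm y)) :
    differential a ((extChartAt (𝓡 n) p).symm y) (grad (n := n) b ((extChartAt (𝓡 n) p).symm y)) =
      innerGrad (metricMat p) (a ∘ (extChartAt (𝓡 n) p).symm)
        (b ∘ (extChartAt (𝓡 n) p).symm) y := by
  rw [grad_eq_sum hy hb, map_sum, innerGrad, dotProduct]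
  refine Finset.sum_congr rfl fun j _ ↦ ?_
  rw [map_smul, differential_coordVec hy ha, smul_eq_mul, mul_comm]
  rfl

theorem inner_grad_grad {p : N} {y : EuclideanSpace ℝ (Fin n)} {a b : N → ℝ}
    (hy : y ∈ (extChartAt (𝓡 n) p).target)
    (ha : MDifferentiableAt (𝓡 n) 𝓘(ℝ, ℝ) a ((extChartAt (𝓡 n) p).symm y))
    (hb : MDifferentiableAt (𝓡 n) 𝓘(ℝ, ℝ) b ((extChartAt (𝓡 n) p).symm y)) :
    Inner.inner ℝ (grad (n := n) a ((extChartAt (𝓡 n) p).symm y))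
        (grad (n := n) b ((extChartAt (𝓡 n) p).symm y)) =
      innerGrad (metricMat p) (a ∘ (extChartAt (𝓡 n) p).symm)
        (b ∘ (extChartAt (𝓡 n) p).symm) y := by
  rw [inner_grad, differential_grad hy ha hb]

theorem isCoordMetric_metricMat [IsContMDiffRiemannianBundle (𝓡 n) ∞ (EuclideanSpace ℝ (Fin n))
      (fun x : N ↦ TangentSpace (𝓡 n) x)] (p : N) :
    IsCoordMetric (metricMat p) (extChartAt (𝓡 n) p).target where
  isOpen := isOpen_extChartAt_target p
  posDef _ hy := posDef_metricMat hy
  smooth i j := by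
    have := IsManifold.of_le (I := 𝓡 n) (M := N) (m := 1) (n := ∞) (by simp)
    set e := trivializationAt (EuclideanSpace ℝ (Fin n)) (TangentSpace (𝓡 n) : N → Type _) p
    set b := (EuclideanSpace.basisFun (Fin n) ℝ).toBasis
    have hs : ∀ i, ContMDiffOn (𝓡 n) ((𝓡 n).prod 𝓘(ℝ, EuclideanSpace ℝ (Fin n))) ∞
        (fun q ↦ (⟨q, e.localFrame b i q⟩ : TotalSpace (EuclideanSpace ℝ (Fin n))
          (TangentSpace (𝓡 n) : N → Type _))) e.baseSet :=
      fun i ↦ e.contMDiffOn_localFrame_baseSet ∞ b i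
    have h1 := (hs i).inner_bundle (hs j)
    -- The coordinate fields are the frame of the tangent bundle trivialization at `p`, whose
    -- smoothness is known.
    have h2 : ∀ y ∈ (extChartAt (𝓡 n) p).target, ∀ i,
        coordVec p i y = e.localFrame b i ((extChartAt (𝓡 n) p).symm y) := by
      intro y hy i
      have hq : (extChartAt (𝓡 n) p).symm y ∈ (chartAt (EuclideanSpace ℝ (Fin n)) p).source := by
        simpa using (extChartAt (𝓡 n) p).map_target hy
      have h3 := TangentBundle.symmL_trivializationAt (𝕜 := ℝ) (I := 𝓡 n) hq
      rw [ModelWithCorners.range_eq_univ, mfderivWithin_univ,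
        (extChartAt (𝓡 n) p).right_inv hy] at h3
      have hq' : (extChartAt (𝓡 n) p).symm y ∈ e.baseSet := hq
      rw [e.localFrame_apply_of_mem_baseSet b hq', coordVec, ← h3]
      have h4 : b i = EuclideanSpace.single i (1 : ℝ) := by simp [b]
      rw [Trivialization.basisAt, Module.Basis.map_apply, h4]
      exact congrFun (e.coe_symmₗ (R := ℝ) hq') _
    have h5 : ContMDiffOn 𝓘(ℝ, EuclideanSpace ℝ (Fin n)) 𝓘(ℝ, ℝ) ∞ (fun y ↦ metricMat p y i j)
        (extChartAt (𝓡 n) p).target := by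
      have h6 := h1.comp (contMDiffOn_extChartAt_symm (I := 𝓡 n) (n := ∞) p) (fun y hy ↦ by
        simpa [e] using (extChartAt (𝓡 n) p).map_target hy)
      refine h6.congr fun y hy ↦ ?_
      simp only [metricMat, Matrix.of_apply, h2 y hy, Function.comp_apply]
    exact h5.contDiffOn

end Chart

/-! ### Chart independence of the Laplacian. -/

section Invariance

open scoped Matrix

variable {n : ℕ} {N : Type*} [TopologicalSpace N] [ChartedSpace (EuclideanSpace ℝ (Fin n)) N]

/-- The image of `O` in the chart at `p`. -/
def chartDomain (p : N) (O : Set N) : Set (EuclideanSpace ℝ (Fin n)) :=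
  (extChartAt (𝓡 n) p).target ∩ (extChartAt (𝓡 n) p).symm ⁻¹' O

theorem isOpen_chartDomain (p : N) {O : Set N} (hO : IsOpen O) :
    IsOpen (chartDomain (n := n) p O) :=
  (continuousOn_extChartAt_symm p).isOpen_inter_preimage (isOpen_extChartAt_target p) hO

theorem map_mem_chartDomain {p q : N} {O : Set N} (hq : q ∈ (extChartAt (𝓡 n) p).source)
    (hO : q ∈ O) : extChartAt (𝓡 n) p q ∈ chartDomain p O :=
  ⟨(extChartAt (𝓡 n) p).map_source hq, by
    rwa [Set.mem_preimage, (extChartAt (𝓡 n) p).left_inv hq]⟩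

theorem mdifferentiableAt_of_contMDiffOn {O : Set N} {a : N → ℝ} {q : N} (hO : IsOpen O)
    (ha : ContMDiffOn (𝓡 n) 𝓘(ℝ, ℝ) ∞ a O) (hq : q ∈ O) :
    MDifferentiableAt (𝓡 n) 𝓘(ℝ, ℝ) a q :=
  (ha.contMDiffAt (hO.mem_nhds hq)).mdifferentiableAt (by simp)

variable [IsManifold (𝓡 n) ∞ N]

theorem contDiffOn_comp_extChartAt_symm (p : N) {O : Set N} {a : N → ℝ}
    (ha : ContMDiffOn (𝓡 n) 𝓘(ℝ, ℝ) ∞ a O) :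
    ContDiffOn ℝ ∞ (a ∘ (extChartAt (𝓡 n) p).symm) (chartDomain p O) :=
  (ha.comp ((contMDiffOn_extChartAt_symm (n := ∞) p).mono Set.inter_subset_left)
    fun _ hy ↦ hy.2).contDiffOn

theorem contMDiffOn_extChartAt_apply (q : N) (k : Fin n) :
    ContMDiffOn (𝓡 n) 𝓘(ℝ, ℝ) ∞ (fun r ↦ extChartAt (𝓡 n) q r k) (extChartAt (𝓡 n) q).source := by
  have h1 : ContMDiff 𝓘(ℝ, EuclideanSpace ℝ (Fin n)) 𝓘(ℝ, ℝ) ∞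
      (EuclideanSpace.proj (𝕜 := ℝ) k : EuclideanSpace ℝ (Fin n) →L[ℝ] ℝ) :=
    ContinuousLinearMap.contMDiff _
  have h2 := contMDiffOn_extChartAt (I := 𝓡 n) (x := q) (n := ∞)
  rw [← extChartAt_source (𝓡 n)] at h2
  exact h1.comp_contMDiffOn h2

omit [IsManifold (𝓡 n) ∞ N] in
theorem dVec_extChartAt_apply (q : N) {y : EuclideanSpace ℝ (Fin n)}
    (hy : y ∈ (extChartAt (𝓡 n) q).target) (k : Fin n) :
    dVec ((fun r ↦ extChartAt (𝓡 n) q r k) ∘ (extChartAt (𝓡 n) q).symm) y = Pi.single k 1 := by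
  ext i
  have h1 : Set.EqOn ((fun r ↦ extChartAt (𝓡 n) q r k) ∘ (extChartAt (𝓡 n) q).symm)
      (fun z ↦ z k) (extChartAt (𝓡 n) q).target := fun z hz ↦ by
    simp only [Function.comp_apply, (extChartAt (𝓡 n) q).right_inv hz]
  rw [dVec, pd_congr (isOpen_extChartAt_target q) hy h1, pd_coord, Pi.single_apply]
  simp only [eq_comm]

variable [RiemannianBundle (fun x : N ↦ TangentSpace (𝓡 n) x)]

variable (n) in
/-- The function `⟨∇a, ∇b⟩`. -/
noncomputable def gradInner (a b : N → ℝ) (q : N) : ℝ :=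
  Inner.inner ℝ (grad (n := n) a q) (grad b q)

theorem eqOn_gradInner_comp (p : N) {O : Set N} {a b : N → ℝ} (hO : IsOpen O)
    (ha : ContMDiffOn (𝓡 n) 𝓘(ℝ, ℝ) ∞ a O) (hb : ContMDiffOn (𝓡 n) 𝓘(ℝ, ℝ) ∞ b O) :
    Set.EqOn (gradInner n a b ∘ (extChartAt (𝓡 n) p).symm)
      (innerGrad (metricMat p) (a ∘ (extChartAt (𝓡 n) p).symm) (b ∘ (extChartAt (𝓡 n) p).symm))
      (chartDomain p O) := fun _ hy ↦
  inner_grad_grad hy.1 (mdifferentiableAt_of_contMDiffOn hO ha hy.2)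
    (mdifferentiableAt_of_contMDiffOn hO hb hy.2)

/-- The component is `dxⁱ(∇h)`, the inner product of the gradients of `xⁱ` and `h`. -/
theorem tangentCoord_grad {p : N} {h : N → ℝ} (hh : MDifferentiableAt (𝓡 n) 𝓘(ℝ, ℝ) h p)
    (i : Fin n) :
    tangentCoord p (grad (n := n) h p) i =
      gradVec (metricMat p) (h ∘ (extChartAt (𝓡 n) p).symm) (extChartAt (𝓡 n) p p) i := by
  have hp := mem_extChartAt_source (I := 𝓡 n) p
  have hy : extChartAt (𝓡 n) p p ∈ (extChartAt (𝓡 n) p).target := mem_extChartAt_target p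
  have hq := (extChartAt (𝓡 n) p).left_inv hp
  have hx : MDifferentiableAt (𝓡 n) 𝓘(ℝ, ℝ) (fun r ↦ extChartAt (𝓡 n) p r i) p :=
    mdifferentiableAt_of_contMDiffOn (isOpen_extChartAt_source p)
      (contMDiffOn_extChartAt_apply p i) hp
  have h1 : tangentCoord p (grad (n := n) h p) i =
      differential (fun r ↦ extChartAt (𝓡 n) p r i) p (grad (n := n) h p) := by
    have hc := mvfderiv_comp_apply p (f := extChartAt (𝓡 n) p)
      (g := (fun z : EuclideanSpace ℝ (Fin n) ↦ z i))
      ((EuclideanSpace.proj (𝕜 := ℝ) i).differentiableAt.mdifferentiableAt)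
      (contMDiffAt_extChartAt.mdifferentiableAt (n := ∞) (by simp)) (grad (n := n) h p)
    have hf : fderiv ℝ (fun z : EuclideanSpace ℝ (Fin n) ↦ z i) (extChartAt (𝓡 n) p p) =
        EuclideanSpace.proj (𝕜 := ℝ) i := (EuclideanSpace.proj (𝕜 := ℝ) i).hasFDerivAt.fderiv
    rw [differential]
    refine Eq.trans ?_ hc.symm
    rw [mvfderiv, mfderiv_eq_fderiv, hf]
    rfl
  have h2 := differential_grad (p := p) hy (a := fun r ↦ extChartAt (𝓡 n) p r i) (b := h)
    (by rwa [hq]) (by rwa [hq])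
  rw [hq] at h2
  rw [h1, h2, innerGrad, dVec_extChartAt_apply p hy, single_one_dotProduct]

variable [IsContMDiffRiemannianBundle (𝓡 n) ∞ (EuclideanSpace ℝ (Fin n))
  (fun x : N ↦ TangentSpace (𝓡 n) x)]

theorem isCoordMetric_chartDomain (p : N) {O : Set N} (hO : IsOpen O) :
    IsCoordMetric (metricMat p) (chartDomain (n := n) p O) :=
  (isCoordMetric_metricMat p).mono (isOpen_chartDomain p hO) Set.inter_subset_left

theorem contMDiffOn_gradInner {O : Set N} {a b : N → ℝ} (hO : IsOpen O)
    (ha : ContMDiffOn (𝓡 n) 𝓘(ℝ, ℝ) ∞ a O) (hb : ContMDiffOn (𝓡 n) 𝓘(ℝ, ℝ) ∞ b O) :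
    ContMDiffOn (𝓡 n) 𝓘(ℝ, ℝ) ∞ (gradInner n a b) O := by
  intro r hr
  have hrs := mem_extChartAt_source (I := 𝓡 n) r
  have h1 : ContDiffAt ℝ ∞ (innerGrad (metricMat r) (a ∘ (extChartAt (𝓡 n) r).symm)
      (b ∘ (extChartAt (𝓡 n) r).symm)) (extChartAt (𝓡 n) r r) :=
    ((isCoordMetric_chartDomain (n := n) r hO).contDiffOn_innerGrad
      (contDiffOn_comp_extChartAt_symm r ha) (contDiffOn_comp_extChartAt_symm r hb)).contDiffAt
      ((isOpen_chartDomain r hO).mem_nhds (map_mem_chartDomain hrs hr))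
  have h2 := h1.contMDiffAt.comp r (contMDiffAt_extChartAt (I := 𝓡 n) (n := ∞) (x := r))
  refine (h2.congr_of_eventuallyEq ?_).contMDiffWithinAt
  filter_upwards [hO.mem_nhds hr, extChartAt_source_mem_nhds (I := 𝓡 n) r] with q hq hqs
  have h3 := eqOn_gradInner_comp r hO ha hb (map_mem_chartDomain hqs hq)
  simpa only [Function.comp_apply, (extChartAt (𝓡 n) r).left_inv hqs] using h3

/-- The Hessian in an arbitrary chart, in terms of the functions `⟨∇a, ∇b⟩`. -/
theorem hessMat_metricMat {p q : N} {O : Set N} {a b h : N → ℝ} (hO : IsOpen O) (hq : q ∈ O)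
    (hqp : q ∈ (extChartAt (𝓡 n) p).source) (hh : ContMDiffOn (𝓡 n) 𝓘(ℝ, ℝ) ∞ h O)
    (ha : ContMDiffOn (𝓡 n) 𝓘(ℝ, ℝ) ∞ a O) (hb : ContMDiffOn (𝓡 n) 𝓘(ℝ, ℝ) ∞ b O) :
    2 * (gradVec (metricMat p) (a ∘ (extChartAt (𝓡 n) p).symm) (extChartAt (𝓡 n) p q) ⬝ᵥ
      hessMat (metricMat p) (h ∘ (extChartAt (𝓡 n) p).symm) (extChartAt (𝓡 n) p q) *ᵥ
        gradVec (metricMat p) (b ∘ (extChartAt (𝓡 n) p).symm) (extChartAt (𝓡 n) p q)) =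
      gradInner n a (gradInner n h b) q + gradInner n b (gradInner n h a) q
        - gradInner n h (gradInner n a b) q := by
  have hG := isCoordMetric_chartDomain (n := n) p hO
  have hy := map_mem_chartDomain hqp hq
  have key : ∀ {c d e : N → ℝ}, ContMDiffOn (𝓡 n) 𝓘(ℝ, ℝ) ∞ c O →
      ContMDiffOn (𝓡 n) 𝓘(ℝ, ℝ) ∞ d O → ContMDiffOn (𝓡 n) 𝓘(ℝ, ℝ) ∞ e O →
      gradInner n c (gradInner n d e) q =
        innerGrad (metricMat p) (c ∘ (extChartAt (𝓡 n) p).symm)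
          (innerGrad (metricMat p) (d ∘ (extChartAt (𝓡 n) p).symm)
            (e ∘ (extChartAt (𝓡 n) p).symm)) (extChartAt (𝓡 n) p q) := by
    intro c d e hc hd he
    have h1 := eqOn_gradInner_comp p hO hc (contMDiffOn_gradInner hO hd he) hy
    rw [Function.comp_apply, (extChartAt (𝓡 n) p).left_inv hqp] at h1
    rw [h1, innerGrad, gradVec, dVec_congr hG.isOpen hy (eqOn_gradInner_comp p hO hd he)]
    rfl
  rw [hG.hessMat_gradVec_gradVec (contDiffOn_comp_extChartAt_symm p hh)
    (contDiffOn_comp_extChartAt_symm p ha) (contDiffOn_comp_extChartAt_symm p hb) hy,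
    key ha hh hb, key hb hh ha, key hh ha hb]

theorem mulVec_dotProduct_of_transpose_eq {P : Matrix (Fin n) (Fin n) ℝ} (hP : Pᵀ = P)
    (v z : Fin n → ℝ) : (P *ᵥ v) ⬝ᵥ z = v ⬝ᵥ P *ᵥ z := by
  rw [Matrix.dotProduct_mulVec, ← Matrix.mulVec_transpose, hP]

/-- To be used with `P = G⁻¹` and `J` the Jacobian of test functions: `M` is then the Gram matrix of
their gradients, and `J P H P Jᵀ` is the Hessian evaluated on them. -/
theorem trace_inv_mul_congr {P J H M : Matrix (Fin n) (Fin n) ℝ} (hM : M = J * P * Jᵀ)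
    (h0 : M.det ≠ 0) : (M⁻¹ * (J * P * H * P * Jᵀ)).trace = (P * H).trace := by
  have hd : J.det ≠ 0 ∧ P.det ≠ 0 := by
    rw [hM, Matrix.det_mul, Matrix.det_mul] at h0
    exact ⟨left_ne_zero_of_mul (left_ne_zero_of_mul h0),
      right_ne_zero_of_mul (left_ne_zero_of_mul h0)⟩
  have hJ := hd.1.isUnit
  have hJt : IsUnit (Jᵀ).det := by rwa [Matrix.det_transpose]
  rw [hM, Matrix.mul_inv_rev, Matrix.mul_inv_rev]
  simp only [Matrix.mul_assoc]
  rw [Matrix.nonsing_inv_mul_cancel_left _ _ hJ, Matrix.nonsing_inv_mul_cancel_left _ _ hd.2.isUnit,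
    Matrix.trace_mul_comm]
  simp only [Matrix.mul_assoc]
  rw [Matrix.mul_nonsing_inv _ hJt, Matrix.mul_one, Matrix.trace_mul_comm]

/-- The trace of the Hessian can be computed in any chart. -/
theorem trace_hessEnd_eq_trace {p q : N} {h : N → ℝ} (hqp : q ∈ (extChartAt (𝓡 n) p).source)
    (hh : ContMDiff (𝓡 n) 𝓘(ℝ, ℝ) ∞ h) :
    (hessEnd (metricMat p) (h ∘ (extChartAt (𝓡 n) p).symm) (extChartAt (𝓡 n) p q)).trace =
      (hessEnd (metricMat q) (h ∘ (extChartAt (𝓡 n) q).symm) (extChartAt (𝓡 n) q q)).trace := by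
  -- The coordinates at `q` serve as test functions in both charts; `M` and `B` below involve no
  -- chart beyond this choice.
  set x : Fin n → N → ℝ := fun k r ↦ extChartAt (𝓡 n) q r k with hx
  set O := (extChartAt (𝓡 n) q).source with hOdef
  have hO : IsOpen O := isOpen_extChartAt_source q
  have hqO : q ∈ O := mem_extChartAt_source q
  have hxs : ∀ k, ContMDiffOn (𝓡 n) 𝓘(ℝ, ℝ) ∞ (x k) O := contMDiffOn_extChartAt_apply q
  set M : Matrix (Fin n) (Fin n) ℝ := Matrix.of fun k l ↦ gradInner n (x k) (x l) q with hM
  set B : Matrix (Fin n) (Fin n) ℝ := Matrix.of fun k l ↦ (1 / 2) *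
    (gradInner n (x k) (gradInner n h (x l)) q + gradInner n (x l) (gradInner n h (x k)) q
        - gradInner n h (gradInner n (x k) (x l)) q) with hB
  have hMc : ∀ c : N, q ∈ (extChartAt (𝓡 n) c).source → ∀ J : Matrix (Fin n) (Fin n) ℝ,
      J = Matrix.of (fun k ↦ dVec (x k ∘ (extChartAt (𝓡 n) c).symm) (extChartAt (𝓡 n) c q)) →
      M = J * (metricMat c (extChartAt (𝓡 n) c q))⁻¹ * Jᵀ := by
    rintro c hc J rfl
    ext k l
    have h1 := eqOn_gradInner_comp c hO (hxs k) (hxs l) (map_mem_chartDomain hc hqO)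
    rw [Function.comp_apply, (extChartAt (𝓡 n) c).left_inv hc] at h1
    rw [hM, Matrix.of_apply, h1, Matrix.mul_assoc]
    rfl
  have hM0 : M.det ≠ 0 := by
    -- In the chart at `q` the Jacobian is the identity, so `M` is the inverse metric. Nondegeneracy
    -- of `M` then makes the Jacobian in any other chart invertible.
    rw [hMc q hqO 1]
    · rw [Matrix.one_mul, Matrix.transpose_one, Matrix.mul_one]
      exact (posDef_metricMat (mem_extChartAt_target q)).inv.det_pos.ne'
    · ext k i
      rw [Matrix.of_apply, dVec_extChartAt_apply q (mem_extChartAt_target q), Matrix.one_apply,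
        Pi.single_apply]
      simp only [eq_comm]
  have key : ∀ c : N, q ∈ (extChartAt (𝓡 n) c).source →
      (hessEnd (metricMat c) (h ∘ (extChartAt (𝓡 n) c).symm) (extChartAt (𝓡 n) c q)).trace =
        (M⁻¹ * B).trace := by
    intro c hc
    have hG := isCoordMetric_chartDomain (n := n) c hO
    have hy := map_mem_chartDomain hc hqO
    have hBc : B = Matrix.of
        (fun k ↦ dVec (x k ∘ (extChartAt (𝓡 n) c).symm) (extChartAt (𝓡 n) c q)) *
        (metricMat c (extChartAt (𝓡 n) c q))⁻¹ *
        hessMat (metricMat c) (h ∘ (extChartAt (𝓡 n) c).symm) (extChartAt (𝓡 n) c q) *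
        (metricMat c (extChartAt (𝓡 n) c q))⁻¹ * (Matrix.of
        (fun k ↦ dVec (x k ∘ (extChartAt (𝓡 n) c).symm) (extChartAt (𝓡 n) c q)))ᵀ := by
      ext k l
      rw [hB, Matrix.of_apply, ← hessMat_metricMat hO hqO hc hh.contMDiffOn (hxs k) (hxs l),
        one_div, inv_mul_cancel_left₀ two_ne_zero]
      simp only [Matrix.mul_assoc]
      refine Eq.trans ?_ (mulVec_dotProduct_of_transpose_eq (hG.transpose_inv_eq hy) _ _)
      rfl
    rw [hBc, trace_inv_mul_congr (hMc c hc _ rfl) hM0]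
    rfl
  rw [key p hqp, key q hqO]

end Invariance

/-! ### Bochner's formula for the logarithm of a weighted harmonic function. -/

section WeightedHarmonic

open scoped Matrix

variable {n : ℕ}

/-- Bochner's formula in coordinates for the logarithm `w` of a weighted harmonic function. -/
theorem IsCoordMetric.bochner_of_weightedHarmonic
    {G : EuclideanSpace ℝ (Fin n) → Matrix (Fin n) (Fin n) ℝ}
    {U : Set (EuclideanSpace ℝ (Fin n))} {y : EuclideanSpace ℝ (Fin n)}
    {f w : EuclideanSpace ℝ (Fin n) → ℝ} (hG : IsCoordMetric G U) (hf : ContDiffOn ℝ ∞ f U)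
    (hw : ContDiffOn ℝ ∞ w U) (hy : y ∈ U)
    (hΔ : ∀ z ∈ U, (hessEnd G w z).trace = innerGrad G f w z - innerGrad G w w z) :
    (1 / 2) * (hessEnd G (innerGrad G w w) y).trace =
      (hessEnd G w y * hessEnd G w y).trace
        + (gradVec G w y ⬝ᵥ ricMat G y *ᵥ gradVec G w y
          + gradVec G w y ⬝ᵥ hessMat G f y *ᵥ gradVec G w y)
        + (1 / 2) * innerGrad G f (innerGrad G w w) y - innerGrad G w (innerGrad G w w) y := by
  have h1 : dVec (fun z ↦ (hessEnd G w z).trace) y =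
      dVec (innerGrad G f w) y - dVec (innerGrad G w w) y := by
    ext i
    rw [dVec, pd_congr hG.isOpen hy hΔ, pd_sub i
      (differentiableAt_of_contDiffOn hG.isOpen (hG.contDiffOn_innerGrad hf hw) hy)
      (differentiableAt_of_contDiffOn hG.isOpen (hG.contDiffOn_innerGrad hw hw) hy)]
    rfl
  have h2 := hG.innerGrad_innerGrad hf hw hy
  rw [hG.bochner hw hy, innerGrad, h1, sub_dotProduct, ← innerGrad, ← innerGrad, h2,
    hG.innerGrad_comm hy (a := innerGrad G w w)]
  ring

variable {N : Type*} [TopologicalSpace N] [ChartedSpace (EuclideanSpace ℝ (Fin n)) N]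
  [IsManifold (𝓡 n) ∞ N] [RiemannianBundle (fun x : N ↦ TangentSpace (𝓡 n) x)]
  [IsContMDiffRiemannianBundle (𝓡 n) ∞ (EuclideanSpace ℝ (Fin n))
    (fun x : N ↦ TangentSpace (𝓡 n) x)]

/-- The two contractions differ by transposing the Hessian, which is symmetric. -/
theorem laplacian_eq_trace {h : N → ℝ} (hh : ContMDiff (𝓡 n) 𝓘(ℝ, ℝ) ∞ h) (p : N) :
    laplacian n h p =
      (hessEnd (metricMat p) (h ∘ (extChartAt (𝓡 n) p).symm) (extChartAt (𝓡 n) p p)).trace := by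
  have hG := isCoordMetric_chartDomain (n := n) p isOpen_univ
  have hy := map_mem_chartDomain (mem_extChartAt_source (I := 𝓡 n) p) (Set.mem_univ p)
  have hs := hG.transpose_hessMat (contDiffOn_comp_extChartAt_symm p hh.contMDiffOn) hy
  have h1 : ∀ i, hessEnd (metricMat p) (h ∘ (extChartAt (𝓡 n) p).symm) (extChartAt (𝓡 n) p p) i i =
      ∑ j, (metricMat p (extChartAt (𝓡 n) p p))⁻¹ i j *
        hessCoord h p i j (extChartAt (𝓡 n) p p) := by
    intro i
    rw [hessEnd, ← hs, Matrix.mul_apply]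
    rfl
  rw [laplacian, Matrix.trace]
  exact Finset.sum_congr rfl fun i _ ↦ (h1 i).symm

omit [IsContMDiffRiemannianBundle (𝓡 n) ∞ (EuclideanSpace ℝ (Fin n))
  (fun x : N ↦ TangentSpace (𝓡 n) x)] in
theorem sum_mul_tangentCoord_grad {p : N} {h : N → ℝ}
    (hh : MDifferentiableAt (𝓡 n) 𝓘(ℝ, ℝ) h p) (T : Matrix (Fin n) (Fin n) ℝ) :
    ∑ i, ∑ j, T i j * tangentCoord p (grad (n := n) h p) i
        * tangentCoord p (grad (n := n) h p) j =
      gradVec (metricMat p) (h ∘ (extChartAt (𝓡 n) p).symm) (extChartAt (𝓡 n) p p) ⬝ᵥ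
        T *ᵥ gradVec (metricMat p) (h ∘ (extChartAt (𝓡 n) p).symm) (extChartAt (𝓡 n) p p) := by
  simp only [tangentCoord_grad hh, dotProduct, Matrix.mulVec, Finset.mul_sum]
  exact Finset.sum_congr rfl fun i _ ↦ Finset.sum_congr rfl fun j _ ↦ by ring

/-- Bochner's formula for the logarithm `w` of a positive weighted harmonic function, with the
Hessian term estimated by the trace. -/
theorem bochner_log_of_isWeightedHarmonic (hn : 0 < n) {f u : N → ℝ}
    (hf : ContMDiff (𝓡 n) 𝓘(ℝ, ℝ) ∞ f) (hu : ContMDiff (𝓡 n) 𝓘(ℝ, ℝ) ∞ u)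
    (hpos : ∀ p, 0 < u p) (hharm : IsWeightedHarmonic n f u) {w : N → ℝ}
    (hw : w = fun q ↦ Real.log (u q)) (p : N) :
    (1 / (n : ℝ)) * (gradInner n f w p - gradInner n w w p) ^ 2
      + (ricci p (grad w p) (grad (n := n) w p) + hessian f p (grad (n := n) w p) (grad w p))
      + (1 / 2) * gradInner n f (gradInner n w w) p - gradInner n w (gradInner n w w) p ≤
      (1 / 2) * laplacian n (gradInner n w w) p := by
  have hws : ContMDiff (𝓡 n) 𝓘(ℝ, ℝ) ∞ w := by
    rw [hw]
    exact fun q ↦ (Real.contDiffAt_log.2 (hpos q).ne').contMDiffAt.comp q (hu q)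
  have hF : ContMDiff (𝓡 n) 𝓘(ℝ, ℝ) ∞ (gradInner n w w) :=
    contMDiffOn_univ.1 (contMDiffOn_gradInner isOpen_univ hws.contMDiffOn hws.contMDiffOn)
  set φ := (extChartAt (𝓡 n) p).symm with hφ
  set y := extChartAt (𝓡 n) p p with hydef
  have hG := isCoordMetric_chartDomain (n := n) p isOpen_univ
  have hps := mem_extChartAt_source (I := 𝓡 n) p
  have hy := map_mem_chartDomain hps (Set.mem_univ p)
  have hφy : φ y = p := (extChartAt (𝓡 n) p).left_inv hps
  have hfU := contDiffOn_comp_extChartAt_symm p hf.contMDiffOn (O := Set.univ)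
  have huU := contDiffOn_comp_extChartAt_symm p hu.contMDiffOn (O := Set.univ)
  have hwU := contDiffOn_comp_extChartAt_symm p hws.contMDiffOn (O := Set.univ)
  have read : ∀ {a b : N → ℝ}, ContMDiff (𝓡 n) 𝓘(ℝ, ℝ) ∞ a → ContMDiff (𝓡 n) 𝓘(ℝ, ℝ) ∞ b →
      Set.EqOn (gradInner n a b ∘ φ) (innerGrad (metricMat p) (a ∘ φ) (b ∘ φ))
        (chartDomain p Set.univ) := fun ha hb ↦
    eqOn_gradInner_comp p isOpen_univ ha.contMDiffOn hb.contMDiffOn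
  have read_at : ∀ {a b : N → ℝ}, ContMDiff (𝓡 n) 𝓘(ℝ, ℝ) ∞ a →
      ContMDiff (𝓡 n) 𝓘(ℝ, ℝ) ∞ b →
      gradInner n a b p = innerGrad (metricMat p) (a ∘ φ) (b ∘ φ) y := fun ha hb ↦ by
    have := read ha hb hy
    rwa [Function.comp_apply, hφy] at this
  have hwφ : w ∘ φ = fun z ↦ Real.log ((u ∘ φ) z) := by rw [hw]; rfl
  have h0 : ∀ z ∈ chartDomain p Set.univ, (u ∘ φ) z ≠ 0 := fun z _ ↦ (hpos _).ne'
  have hΔ : ∀ z ∈ chartDomain p Set.univ, (hessEnd (metricMat p) (w ∘ φ) z).trace =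
      innerGrad (metricMat p) (f ∘ φ) (w ∘ φ) z - innerGrad (metricMat p) (w ∘ φ) (w ∘ φ) z := by
    intro z hz
    have hzs : φ z ∈ (extChartAt (𝓡 n) p).source := (extChartAt (𝓡 n) p).map_target hz.1
    -- Harmonicity at `φ z` is expressed in the chart centred at `φ z`; this moves it to the chart
    -- at `p`.
    have h1 := trace_hessEnd_eq_trace hzs hu
    rw [← laplacian_eq_trace hu, (extChartAt (𝓡 n) p).right_inv hz.1] at h1
    have h2 : laplacian n u (φ z) = gradInner n f u (φ z) := sub_eq_zero.1 (hharm (φ z))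
    have h3 : innerGrad (metricMat p) (f ∘ φ) (u ∘ φ) z =
        (u ∘ φ) z * innerGrad (metricMat p) (f ∘ φ) (w ∘ φ) z := by
      rw [innerGrad, gradVec, hG.dVec_eq_smul_dVec_log huU h0 hz, Matrix.mulVec_smul,
        dotProduct_smul, hwφ]
      rfl
    have h4 := hG.trace_hessEnd_eq_log huU h0 hz
    rw [h1, h2, ← Function.comp_apply (f := gradInner n f u), read hf hu hz, h3, ← hwφ] at h4
    linarith [mul_left_cancel₀ (h0 z hz) h4]
  have hb := hG.bochner_of_weightedHarmonic hfU hwU hy hΔ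
  have hFr : laplacian n (gradInner n w w) p =
      (hessEnd (metricMat p) (innerGrad (metricMat p) (w ∘ φ) (w ∘ φ)) y).trace := by
    rw [laplacian_eq_trace hF, hessEnd, hessMat_congr hG.isOpen hy (read hws hws)]
    rfl
  have hcs := sq_trace_mul_le (hG.posDef y hy).inv (hG.transpose_hessMat hwU hy) hn
  rw [← hessEnd, hΔ y hy] at hcs
  have hFg : ∀ {a : N → ℝ}, ContMDiff (𝓡 n) 𝓘(ℝ, ℝ) ∞ a → gradInner n a (gradInner n w w) p =
      innerGrad (metricMat p) (a ∘ φ) (innerGrad (metricMat p) (w ∘ φ) (w ∘ φ)) y := by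
    intro a ha
    rw [read_at ha hF, innerGrad, gradVec, dVec_congr hG.isOpen hy (read hws hws)]
    rfl
  have hwd : MDifferentiableAt (𝓡 n) 𝓘(ℝ, ℝ) w p := (hws p).mdifferentiableAt (by simp)
  have hr : ricci p (grad (n := n) w p) (grad w p) = gradVec (metricMat p) (w ∘ φ) y ⬝ᵥ
      ricMat (metricMat p) y *ᵥ gradVec (metricMat p) (w ∘ φ) y :=
    sum_mul_tangentCoord_grad hwd (ricMat (metricMat p) y)
  have hh : hessian f p (grad (n := n) w p) (grad w p) = gradVec (metricMat p) (w ∘ φ) y ⬝ᵥ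
      hessMat (metricMat p) (f ∘ φ) y *ᵥ gradVec (metricMat p) (w ∘ φ) y :=
    sum_mul_tangentCoord_grad hwd (hessMat (metricMat p) (f ∘ φ) y)
  rw [hFr, hb, hr, hh, hFg hf, hFg hws, read_at hf hws, read_at hws hws]
  linarith

end WeightedHarmonic

end RiemGeom

/-! ### The gradient estimate. -/

theorem theorem2 {n : ℕ} (hn : 0 < n)
    {N : Type*} [TopologicalSpace N] [T2Space N] [SecondCountableTopology N]
    [ChartedSpace (EuclideanSpace ℝ (Fin n)) N] [IsManifold (𝓡 n) ∞ N]
    [RiemannianBundle (fun x : N ↦ TangentSpace (𝓡 n) x)]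
    [IsContMDiffRiemannianBundle (𝓡 n) ∞ (EuclideanSpace ℝ (Fin n))
      (fun x : N ↦ TangentSpace (𝓡 n) x)]
    (m : ℝ≥0∞) (hm : 0 < m) (lam ρ : ℝ)
    (f : N → ℝ) (hf : ContMDiff (𝓡 n) 𝓘(ℝ, ℝ) ∞ f)
    (hRic : ∀ (p : N) (v : TangentSpace (𝓡 n) p),
      ricci p v v + hessian f p v v - (m⁻¹).toReal * (differential f p v) ^ 2
        ≥ lam * inner ℝ v v + ρ * scalarCurvature n p * inner ℝ v v)
    (u : N → ℝ) (hu : ContMDiff (𝓡 n) 𝓘(ℝ, ℝ) ∞ u) (hpos : ∀ p, 0 < u p)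
    (hharm : IsWeightedHarmonic n f u)
    (w F : N → ℝ) (hw : w = fun q ↦ Real.log (u q)) (hF : F = gradSq n w) (p : N) :
    (1 / 2) * laplacian n F p ≥
      (lam + ρ * scalarCurvature n p) * F p + (1 / (n : ℝ)) * (F p) ^ 2
        - (2 / (n : ℝ)) * ‖grad (n := n) f p‖ * (F p) ^ (3 / 2 : ℝ)
        - ‖grad (n := n) F p‖ * (F p) ^ (1 / 2 : ℝ)
        + (m⁻¹).toReal * (differential f p (grad (n := n) w p)) ^ 2
        + (1 / 2) * inner ℝ (grad (n := n) f p) (grad F p) := by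
  have hFeq : F = gradInner n w w := by
    rw [hF]
    funext q
    exact (real_inner_self_eq_norm_sq _).symm
  have hb := bochner_log_of_isWeightedHarmonic hn hf hu hpos hharm hw p
  -- For `m = ∞` the coefficient `(m⁻¹).toReal` is `0`, so both cases are covered at once.
  have hr := hRic p (grad w p)
  rw [← hFeq] at hb
  have hFF : F p = ‖grad (n := n) w p‖ ^ 2 := by rw [hF, gradSq]
  have hFi : Inner.inner ℝ (grad (n := n) w p) (grad w p) = F p := by
    rw [hFF, real_inner_self_eq_norm_sq]
  have h1 : gradInner n f F p = Inner.inner ℝ (grad (n := n) f p) (grad F p) := rfl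
  have h2 : gradInner n w F p ≤ ‖grad (n := n) F p‖ * (F p) ^ (1 / 2 : ℝ) := by
    rw [← Real.sqrt_eq_rpow, hFF, Real.sqrt_sq (norm_nonneg _), mul_comm]
    exact real_inner_le_norm _ _
  have h3 : (F p) ^ 2 - 2 * ‖grad (n := n) f p‖ * (F p) ^ (3 / 2 : ℝ) ≤
      (gradInner n f w p - F p) ^ 2 := by
    have h4 : (F p) ^ (3 / 2 : ℝ) = F p * ‖grad (n := n) w p‖ := by
      have h5 : (3 / 2 : ℝ) = 1 + 1 / 2 := by norm_num
      have h6 : 0 ≤ F p := hFF ▸ sq_nonneg _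
      rw [h5, Real.rpow_add_of_nonneg h6 zero_le_one (by norm_num), Real.rpow_one,
        ← Real.sqrt_eq_rpow]
      congr 1
      rw [hFF, Real.sqrt_sq (norm_nonneg _)]
    have h7 : gradInner n f w p ≤ ‖grad (n := n) f p‖ * ‖grad (n := n) w p‖ :=
      real_inner_le_norm _ _
    have h8 := mul_le_mul_of_nonneg_left h7 (hFF ▸ sq_nonneg _ : 0 ≤ F p)
    rw [h4]
    -- Expand the square, drop `⟨∇f, ∇w⟩²` and bound the cross term by `h8`.
    nlinarith [sq_nonneg (gradInner n f w p)]
  have h9 := mul_le_mul_of_nonneg_left h3 (by positivity : 0 ≤ 1 / (n : ℝ))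
  rw [hFi] at hr
  rw [h1] at hb
  have h10 : 2 / (n : ℝ) = 2 * (1 / n) := by ring
  rw [h10]
  linarith
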